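/- **Setting.** Let $\mathbb F$ be a field. An *interval* of a poset is a nonempty subset $I$ that is convex ($p,q\in I$, $p\le r\le q$ imply $r\in I$) and connected (any two points of $I$ are joined by a finite sequence in $I$ whose consecutive terms are comparable). The interval module $\mathbb I_I$ is $\mathbb F$ at the points of $I$ and $0$ elsewhere, with structure maps $\mathrm{id}_{\mathbb F}$ inside $I$ and $0$ otherwise; a module is *interval decomposable* if it is isomorphic to a direct sum of interval modules. For a pointwise finite-dimensional module $M$ over a finite poset $P$ and an interval $I$ of $P$, $\mathrm{rk}(M)(I)$ denotes the rank of the canonical map $\varprojlim M|_I\to\varinjlim M|_I$. An interval $I$ with $\mathrm{rk}(M)(I)>0$ is *maximal* for $M$ if $\mathrm{rk}(M)(J)=0$ for all intervals $J\supsetneq I$ of $P$. Let $P$ be a finite interval of $\mathbb Z^2$ (product order), $K$ a finite abstract simplicial complex, $\mathcal F$ an order-preserving map from $P$ to the poset of subcomplexes of $K$, $n\ge 0$, and $M_{\mathcal F}=H_n(\mathcal F(-);\mathbb F)$ the induced $P$-module. **Procedure TrueInterval.** Put $M_1:=M_{\mathcal F}$. As long as the current module $M_i$ is nonzero at some point,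 choose a point $p$ with $\dim (M_i)_p\ne 0$ and an interval $I_i\ni p$ that is maximal for $M_i$, put $\mu_{I_i}:=\mathrm{rk}(M_i)(I_i)$, choose a summand $N_i\le M_i$ with $N_i\cong\mathbb I_{I_i}^{\mu_{I_i}}$, output $(I_i,\mu_{I_i})$, and continue with $M_{i+1}:=M_i/N_i$. Stop when the current module is zero at every point. **Proposition.** Suppose that $M_{\mathcal F}$ is interval decomposable. Then TrueInterval can always be carried out, whatever choices have been made so far: for each point $p$ with $\dim(M_i)_p\neq0$ there is an interval containing $p$ that is maximal for $M_i$, and for each interval $I$ that is maximal for $M_i$ there is a summand of $M_i$ isomorphic to $\mathbb I_{I}^{\mathrm{rk}(M_i)(I)}$. The procedure terminates: the number of its iterations is bounded by a number that does not depend on the choices. Whenever it has stopped, with output $(I_1,\mu_{I_1}),\dots,(I_k,\mu_{I_k})$, the intervals $I_1,\dots,I_k$ are pairwise distinct, each multiplicity is positive and satisfies $$\mu_{I_i}=\mathrm{rk}(M_{\mathcal F})(I_i)-\sum_{j<i,\ I_j\supseteq I_i}\mu_{I_j},$$ and $$M_{\mathcal F}\cong\bigoplus_{i=1}^k\mathbb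 I_{I_i}^{\mu_{I_i}}.$$ -/

import Mathlib

set_option maxSynthPendingDepth 3

universe u v w x y

noncomputable section

/-! ### Intervals of a poset -/

/-- A poset is connected if any two points are joined by a finite sequence of points
in which consecutive points are comparable. -/
def PosetConnected (P : Type w) [PartialOrder P] : Prop :=
  ∀ p q : P, Relation.ReflTransGen (fun a b : P => a ≤ b ∨ b ≤ a) p q

/-- Intervals of a poset: nonempty, convex and connected subsets. -/
structure PosetInterval (P : Type w) [PartialOrder P] where
  carrier : Set P
  nonempty : carrier.Nonempty
  convex : ∀ ⦃p q r : P⦄, p ∈ carrier → q ∈ carrier → p ≤ r → r ≤ q → r ∈ carrier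
  connected : PosetConnected carrier

/-! ### Persistence modules -/

/-- A persistence module over `P`, i.e. a functor from the poset `P` to `𝔽`-vector spaces.
(Pointwise finite-dimensionality is not part of the structure.) -/
structure PersistenceModule (𝔽 : Type u) [Field 𝔽] (P : Type w) [PartialOrder P] where
  obj : P → Type v
  [addCommGroup : ∀ p, AddCommGroup (obj p)]
  [module : ∀ p, Module 𝔽 (obj p)]
  map : ∀ {p q : P}, p ≤ q → obj p →ₗ[𝔽] obj q
  map_id : ∀ p : P, map (le_refl p) = LinearMap.id
  map_comp : ∀ {p q r : P} (h : p ≤ q) (h' : q ≤ r), map (h.trans h') = map h' ∘ₗ map h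

attribute [instance] PersistenceModule.addCommGroup PersistenceModule.module

namespace PersistenceModule

variable {𝔽 : Type u} [Field 𝔽] {P : Type w} [PartialOrder P]

/-- Isomorphisms of persistence modules: natural families of linear isomorphisms. -/
structure Iso (M : PersistenceModule.{u, v, w} 𝔽 P) (N : PersistenceModule.{u, x, w} 𝔽 P) where
  equiv : ∀ p, M.obj p ≃ₗ[𝔽] N.obj p
  naturality : ∀ {p q : P} (h : p ≤ q) (a : M.obj p),
    equiv q (M.map h a) = N.map h (equiv p a)

/-- `M` and `N` are isomorphic. -/
def IsIsomorphic (M : PersistenceModule.{u, v, w} 𝔽 P)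
    (N : PersistenceModule.{u, x, w} 𝔽 P) : Prop :=
  Nonempty (Iso M N)

/-- The dimension of `M` at the point `p`. -/
def dim (M : PersistenceModule.{u, v, w} 𝔽 P) (p : P) : ℕ :=
  Module.finrank 𝔽 (M.obj p)

/-- The restriction of `M` to a subposet. -/
def restrict (M : PersistenceModule.{u, v, w} 𝔽 P) (S : Set P) :
    PersistenceModule.{u, v, w} 𝔽 S where
  obj p := M.obj p
  map {p q} h := M.map (show (p : P) ≤ q from h)
  map_id p := M.map_id p
  map_comp {p q r} h h' :=
    M.map_comp (show (p : P) ≤ q from h) (show (q : P) ≤ r from h')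

/-- The external direct sum of a family of persistence modules, formed pointwise. -/
def directSum {J : Type y} (M : J → PersistenceModule.{u, v, w} 𝔽 P) :
    PersistenceModule.{u, max v y, w} 𝔽 P where
  obj p := DirectSum J fun j => (M j).obj p
  map h := DirectSum.lmap fun j => (M j).map h
  map_id p := by simp [map_id]
  map_comp h h' := by
    rw [← DirectSum.lmap_comp]
    exact congrArg DirectSum.lmap (funext fun j => (M j).map_comp h h')

/-- The interval module of `I`: at `p` it is the space of functions from the proofs of `p ∈ I`
to `𝔽`, which is a copy of `𝔽` if `p ∈ I` and the zero space otherwise.  The structure map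
from `p` to `q` is the identity of `𝔽` if `p, q ∈ I`, and zero otherwise. -/
def intervalModule (𝔽 : Type u) [Field 𝔽] (I : PosetInterval P) :
    PersistenceModule.{u, u, w} 𝔽 P where
  obj p := PLift (p ∈ I.carrier) → 𝔽
  map {p q} _ :=
    open Classical in
    { toFun := fun f _ => if hp : p ∈ I.carrier then f ⟨hp⟩ else 0
      map_add' := by
        intro f g
        funext hq
        by_cases hp : p ∈ I.carrier <;> simp [hp]
      map_smul' := by
        intro c f
        funext hq
        by_cases hp : p ∈ I.carrier <;> simp [hp] }
  map_id p := by
    ext f ⟨hp⟩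
    simp [hp]
  map_comp {p q r} h h' := by
    ext f ⟨hr⟩
    by_cases hp : p ∈ I.carrier
    · have hq : q ∈ I.carrier := I.convex hp hr h h'
      simp [hp, hq]
    · simp [hp]

/-- The direct sum of `m` copies of the interval module of `I`. -/
def intervalPower (𝔽 : Type u) [Field 𝔽] (I : PosetInterval P) (m : ℕ) :
    PersistenceModule.{u, u, w} 𝔽 P :=
  directSum fun _ : Fin m => intervalModule 𝔽 I

/-- `M` is isomorphic to a direct sum of interval modules. -/
def IsIntervalDecomposable (M : PersistenceModule.{u, v, w} 𝔽 P) : Prop :=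
  ∃ (J : Type) (I : J → PosetInterval P),
    M.IsIsomorphic (directSum fun j => intervalModule 𝔽 (I j))

/-! ### Submodules, summands and quotients -/

/-- A submodule of a persistence module. -/
structure Sub (M : PersistenceModule.{u, v, w} 𝔽 P) where
  space : ∀ p, Submodule 𝔽 (M.obj p)
  map_mem : ∀ {p q : P} (h : p ≤ q), ∀ a ∈ space p, M.map h a ∈ space q

/-- A submodule, as a persistence module. -/
def Sub.toModule {M : PersistenceModule.{u, v, w} 𝔽 P} (N : Sub M) :
    PersistenceModule.{u, v, w} 𝔽 P where
  obj p := N.space p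
  map h := (M.map h).restrict (N.map_mem h)
  map_id p := by
    ext a
    simp [map_id]
  map_comp h h' := by
    ext a
    exact LinearMap.congr_fun (M.map_comp h h') (a : M.obj _)

/-- A submodule is a summand if it has a complementary submodule. -/
def Sub.IsSummand {M : PersistenceModule.{u, v, w} 𝔽 P} (N : Sub M) : Prop :=
  ∃ N' : Sub M, ∀ p, IsCompl (N.space p) (N'.space p)

/-- The quotient of a persistence module by a submodule, formed pointwise. -/
def quotient (M : PersistenceModule.{u, v, w} 𝔽 P) (N : Sub M) :
    PersistenceModule.{u, v, w} 𝔽 P where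
  obj p := M.obj p ⧸ N.space p
  map {p q} h := (N.space p).mapQ (N.space q) (M.map h) (N.map_mem h)
  map_id p := by
    ext a
    simp [map_id]
  map_comp h h' := by
    ext a
    exact congrArg (N.space _).mkQ (LinearMap.congr_fun (M.map_comp h h') a)

/-! ### The generalized rank -/

/-- The limit of `M`: the space of sections of `M`. -/
def limit (M : PersistenceModule.{u, v, w} 𝔽 P) : Submodule 𝔽 (∀ p, M.obj p) where
  carrier := {s | ∀ (p q : P) (h : p ≤ q), M.map h (s p) = s q}
  add_mem' := by
    intro s t hs ht p q h
    simp [hs p q h, ht p q h]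
  zero_mem' := by
    intro p q h
    simp
  smul_mem' := by
    intro c s hs p q h
    simp [hs p q h]

open Classical in
/-- The subspace of the direct sum of all `M p` that is generated by the differences of vectors
which are identified in the colimit. -/
def colimitRelations (M : PersistenceModule.{u, v, w} 𝔽 P) :
    Submodule 𝔽 (DirectSum P fun p => M.obj p) :=
  Submodule.span 𝔽 {z | ∃ (p q : P) (h : p ≤ q) (a : M.obj p),
    z = DirectSum.lof 𝔽 P M.obj p a - DirectSum.lof 𝔽 P M.obj q (M.map h a)}

/-- The colimit of `M`. -/
abbrev colimit (M : PersistenceModule.{u, v, w} 𝔽 P) : Type (max v w) :=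
  (DirectSum P fun p => M.obj p) ⧸ M.colimitRelations

/-- The projection from the limit. -/
def limitProj (M : PersistenceModule.{u, v, w} 𝔽 P) (p : P) : M.limit →ₗ[𝔽] M.obj p :=
  LinearMap.proj p ∘ₗ M.limit.subtype

open Classical in
/-- The injection into the colimit. -/
def colimitInj (M : PersistenceModule.{u, v, w} 𝔽 P) (p : P) : M.obj p →ₗ[𝔽] M.colimit :=
  M.colimitRelations.mkQ ∘ₗ DirectSum.lof 𝔽 P M.obj p

/-- The canonical limit-to-colimit map, computed through the point `p`. -/
def limitToColimit (M : PersistenceModule.{u, v, w} 𝔽 P) (p : P) : M.limit →ₗ[𝔽] M.colimit :=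
  M.colimitInj p ∘ₗ M.limitProj p

theorem limitToColimit_eq_of_le (M : PersistenceModule.{u, v, w} 𝔽 P) {p q : P} (h : p ≤ q) :
    M.limitToColimit p = M.limitToColimit q := by
  classical
  ext s
  have hs : M.map h (s.1 p) = s.1 q := s.2 p q h
  simp only [limitToColimit, colimitInj, limitProj, LinearMap.comp_apply,
    Submodule.mkQ_apply, Submodule.subtype_apply, LinearMap.proj_apply]
  rw [Submodule.Quotient.eq]
  refine Submodule.subset_span ⟨p, q, h, s.1 p, ?_⟩
  rw [hs]

/-- On a connected poset the limit-to-colimit map does not depend on the chosen point. -/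
theorem limitToColimit_eq (hP : PosetConnected P) (M : PersistenceModule.{u, v, w} 𝔽 P)
    (p q : P) : M.limitToColimit p = M.limitToColimit q := by
  induction hP p q with
  | refl => rfl
  | tail _ hbc ih =>
    rcases hbc with h | h
    · exact ih.trans (M.limitToColimit_eq_of_le h)
    · exact ih.trans (M.limitToColimit_eq_of_le h).symm

/-- The generalized rank of a module over a nonempty (connected) poset: the rank of the
canonical limit-to-colimit map. -/
def generalizedRank [Nonempty P] (M : PersistenceModule.{u, v, w} 𝔽 P) : ℕ :=
  Module.finrank 𝔽 (LinearMap.range (M.limitToColimit (Classical.arbitrary P)))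

/-- The generalized rank invariant: the generalized rank of the restriction of `M` to `I`. -/
def rk (M : PersistenceModule.{u, v, w} 𝔽 P) (I : PosetInterval P) : ℕ :=
  haveI : Nonempty I.carrier := I.nonempty.to_subtype
  (M.restrict I.carrier).generalizedRank

/-- `I` has positive generalized rank and every strictly larger interval has generalized
rank zero. -/
def IsMaximalInterval (M : PersistenceModule.{u, v, w} 𝔽 P) (I : PosetInterval P) : Prop :=
  0 < M.rk I ∧ ∀ J : PosetInterval P, I.carrier ⊂ J.carrier → M.rk J = 0

/-! ### The procedure -/

/-- `N` is a summand that may be peeled off together with the interval `I`: it is isomorphic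
to the direct sum of `rk M I` copies of the interval module of `I`. -/
def IsPeelable (M : PersistenceModule.{u, v, w} 𝔽 P) (I : PosetInterval P) (N : Sub M) : Prop :=
  N.IsSummand ∧ N.toModule.IsIsomorphic (intervalPower 𝔽 I (M.rk I))

/-- One iteration of the procedure: choose a point `p` at which the current module `M` is
nonzero and a maximal interval `I` containing `p`, and replace `M` by its quotient by
a summand isomorphic to the direct sum of `rk M I` copies of the interval module of `I`. -/
def PeelStep (M : PersistenceModule.{u, v, w} 𝔽 P) (I : PosetInterval P)
    (M' : PersistenceModule.{u, v, w} 𝔽 P) : Prop :=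
  ∃ p : P, M.dim p ≠ 0 ∧ p ∈ I.carrier ∧ M.IsMaximalInterval I ∧
    ∃ N : Sub M, M.IsPeelable I N ∧ M' = M.quotient N

/-- The first `k` iterations of an execution of the procedure with input `M`. -/
structure TrueIntervalRun (M : PersistenceModule.{u, v, w} 𝔽 P) (k : ℕ) where
  stage : Fin (k + 1) → PersistenceModule.{u, v, w} 𝔽 P
  interval : Fin k → PosetInterval P
  stage_zero : stage 0 = M
  step : ∀ i : Fin k, PeelStep (stage i.castSucc) (interval i) (stage i.succ)

namespace TrueIntervalRun

variable {M : PersistenceModule.{u, v, w} 𝔽 P} {k : ℕ}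

/-- The module that remains after the `k` iterations. -/
def final (r : TrueIntervalRun M k) : PersistenceModule.{u, v, w} 𝔽 P :=
  r.stage (Fin.last k)

/-- The execution has stopped: there is no point at which the remaining module is nonzero. -/
def IsComplete (r : TrueIntervalRun M k) : Prop :=
  ∀ p : P, r.final.dim p = 0

/-- The multiplicity that is output with the `i`-th interval: its generalized rank in the
module that is present when the interval is chosen. -/
def mult (r : TrueIntervalRun M k) (i : Fin k) : ℕ :=
  (r.stage i.castSucc).rk (r.interval i)

open Classical in
/-- The number of intervals containing the `i`-th interval, counted with multiplicity, that have
been output before it. -/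
def peeledBefore (r : TrueIntervalRun M k) (i : Fin k) : ℕ :=
  ∑ j : Fin k, if j < i ∧ (r.interval i).carrier ⊆ (r.interval j).carrier then r.mult j else 0

end TrueIntervalRun

end PersistenceModule

/-! ### Simplicial homology and the module of a filtration -/

namespace SimplicialHomology

variable (𝔽 : Type u) [Field 𝔽] {V : Type v}

/-- The `n`-chains of `L`, spanned by the faces with `n + 1` vertices. -/
def chains (L : PreAbstractSimplicialComplex V) (n : ℕ) : Submodule 𝔽 (Finset V →₀ 𝔽) :=
  Finsupp.supported 𝔽 𝔽 {σ | σ ∈ L.faces ∧ σ.card = n + 1}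

theorem chains_mono {𝔽 : Type u} [Field 𝔽] {L L' : PreAbstractSimplicialComplex V} (h : L ≤ L') (n : ℕ) :
    chains 𝔽 L n ≤ chains 𝔽 L' n :=
  Finsupp.supported_mono fun _ hσ => ⟨h hσ.1, hσ.2⟩

theorem chains_finite {L : PreAbstractSimplicialComplex V} (hL : L.faces.Finite) (n : ℕ) :
    Module.Finite 𝔽 (chains 𝔽 L n) := by
  have : Finite {σ | σ ∈ L.faces ∧ σ.card = n + 1} := (hL.subset fun _ hσ => hσ.1).to_subtype
  exact Module.Finite.equiv
    (Finsupp.supportedEquivFinsupp (M := 𝔽) (R := 𝔽) {σ | σ ∈ L.faces ∧ σ.card = n + 1}).symm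

variable [LinearOrder V]

/-- The simplicial boundary operator on linear combinations of finite sets of vertices, with the
signs given by the order of the vertices; it vanishes on single vertices. -/
def boundary : (Finset V →₀ 𝔽) →ₗ[𝔽] (Finset V →₀ 𝔽) :=
  Finsupp.linearCombination 𝔽 fun σ : Finset V =>
    if 1 < σ.card then
      ∑ a ∈ σ, Finsupp.single (σ.erase a) ((-1 : 𝔽) ^ (σ.filter (· < a)).card)
    else 0

/-- The `n`-cycles of `L`. -/
def cycles (L : PreAbstractSimplicialComplex V) (n : ℕ) : Submodule 𝔽 (Finset V →₀ 𝔽) :=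
  chains 𝔽 L n ⊓ LinearMap.ker (boundary 𝔽)

/-- The `n`-boundaries of `L`. -/
def boundaries (L : PreAbstractSimplicialComplex V) (n : ℕ) : Submodule 𝔽 (Finset V →₀ 𝔽) :=
  (chains 𝔽 L (n + 1)).map (boundary 𝔽)

/-- The `n`-th simplicial homology of `L` with coefficients in `𝔽`. -/
abbrev homology (L : PreAbstractSimplicialComplex V) (n : ℕ) : Type (max u v) :=
  cycles 𝔽 L n ⧸ (boundaries 𝔽 L n).submoduleOf (cycles 𝔽 L n)

variable {𝔽}

theorem cycles_mono {L L' : PreAbstractSimplicialComplex V} (h : L ≤ L') (n : ℕ) :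
    cycles 𝔽 L n ≤ cycles 𝔽 L' n :=
  inf_le_inf_right _ (chains_mono h n)

theorem boundaries_mono {L L' : PreAbstractSimplicialComplex V} (h : L ≤ L') (n : ℕ) :
    boundaries 𝔽 L n ≤ boundaries 𝔽 L' n :=
  Submodule.map_mono (chains_mono h (n + 1))

variable (𝔽) in
/-- The map induced on homology by an inclusion of complexes. -/
def homologyMap {L L' : PreAbstractSimplicialComplex V} (h : L ≤ L') (n : ℕ) :
    homology 𝔽 L n →ₗ[𝔽] homology 𝔽 L' n :=
  Submodule.mapQ _ _ (Submodule.inclusion (cycles_mono h n))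
    fun _ ha => boundaries_mono h n ha

theorem boundary_sign {σ : Finset V} {a b : V} (ha : a ∈ σ) (hab : a < b) :
    (-1 : 𝔽) ^ (σ.filter (· < a)).card * (-1 : 𝔽) ^ ((σ.erase a).filter (· < b)).card +
      (-1 : 𝔽) ^ (σ.filter (· < b)).card * (-1 : 𝔽) ^ ((σ.erase b).filter (· < a)).card = 0 := by
  have h1 : (σ.erase b).filter (· < a) = σ.filter (· < a) := by
    ext c
    simp only [Finset.mem_filter, Finset.mem_erase]
    exact ⟨fun h => ⟨h.1.2, h.2⟩, fun h => ⟨⟨(h.2.trans hab).ne, h.1⟩, h.2⟩⟩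
  have h2 : (σ.erase a).filter (· < b) = (σ.filter (· < b)).erase a := by
    ext c
    simp only [Finset.mem_filter, Finset.mem_erase]
    tauto
  have h3 : (σ.filter (· < b)).card = ((σ.filter (· < b)).erase a).card + 1 :=
    (Finset.card_erase_add_one (Finset.mem_filter.2 ⟨ha, hab⟩)).symm
  rw [h1, h2, h3, pow_succ]
  ring

/-- The composition of two boundary operators is zero. -/
theorem boundary_boundary (c : Finset V →₀ 𝔽) : boundary 𝔽 (boundary 𝔽 c) = 0 := by
  suffices h : boundary 𝔽 ∘ₗ boundary 𝔽 = (0 : (Finset V →₀ 𝔽) →ₗ[𝔽] (Finset V →₀ 𝔽)) from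
    LinearMap.congr_fun h c
  refine Finsupp.lhom_ext' fun σ => LinearMap.ext_ring ?_
  have key : ∀ (τ : Finset V) (r : 𝔽), boundary 𝔽 (Finsupp.single τ r) =
      if 1 < τ.card then
        ∑ a ∈ τ, Finsupp.single (τ.erase a) (r * (-1 : 𝔽) ^ (τ.filter (· < a)).card)
      else 0 := by
    intro τ r
    rw [boundary, Finsupp.linearCombination_single]
    split_ifs
    · simp [Finset.smul_sum]
    · simp
  simp only [LinearMap.comp_apply, Finsupp.lsingle_apply, LinearMap.zero_apply, key, one_mul]
  by_cases h1 : 1 < σ.card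
  · rw [if_pos h1, map_sum]
    simp only [key]
    by_cases h2 : 2 < σ.card
    · rw [Finset.sum_congr rfl fun a ha => if_pos (by rw [Finset.card_erase_of_mem ha]; omega),
        Finset.sum_sigma']
      refine Finset.sum_involution (fun x _ => ⟨x.2, x.1⟩) ?_ ?_ ?_ ?_
      · rintro ⟨a, b⟩ hx
        simp only [Finset.mem_sigma, Finset.mem_erase] at hx
        obtain ⟨ha, hba, hb⟩ := hx
        simp only [Finset.erase_right_comm (a := b) (b := a), ← Finsupp.single_add]
        rcases lt_or_gt_of_ne hba with h | h
        · rw [add_comm, boundary_sign hb h, Finsupp.single_zero]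
        · rw [boundary_sign ha h, Finsupp.single_zero]
      · rintro ⟨a, b⟩ hx _ he
        simp only [Finset.mem_sigma, Finset.mem_erase] at hx
        exact hx.2.1 (congrArg Sigma.fst he)
      · rintro ⟨a, b⟩ hx
        simp only [Finset.mem_sigma, Finset.mem_erase] at hx ⊢
        exact ⟨hx.2.2, hx.2.1.symm, hx.1⟩
      · rintro ⟨a, b⟩ hx
        rfl
    · refine Finset.sum_eq_zero fun a ha => if_neg ?_
      rw [Finset.card_erase_of_mem ha]
      omega
  · rw [if_neg h1, map_zero]

theorem homology_finite {L : PreAbstractSimplicialComplex V} (hL : L.faces.Finite) (n : ℕ) :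
    Module.Finite 𝔽 (homology 𝔽 L n) := by
  have := chains_finite 𝔽 hL n
  have : Module.Finite 𝔽 (cycles 𝔽 L n) := Submodule.finiteDimensional_of_le inf_le_left
  exact Module.Finite.quotient _ _

end SimplicialHomology

/-- The persistence module induced by a simplicial filtration `F` of `K` through homology in
degree `n` with coefficients in `𝔽`. -/
def filtrationModule (𝔽 : Type u) [Field 𝔽] {V : Type v} [LinearOrder V] {P : Type w}
    [PartialOrder P] {K : PreAbstractSimplicialComplex V} (F : P →o Set.Iic K) (n : ℕ) :
    PersistenceModule.{u, max u v, w} 𝔽 P where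
  obj p := SimplicialHomology.homology 𝔽 (F p).1 n
  map h := SimplicialHomology.homologyMap 𝔽 (F.monotone h) n
  map_id p := by
    ext a
    rfl
  map_comp h h' := by
    ext a
    rfl

end

noncomputable section

open Module

/-! A decomposition into interval modules is recorded as a `Barcode`: a basis at each point, indexed
by the bars through it and compatible with the structure maps. Over a finite poset, pointwise finite
dimension leaves finitely many bars. The rank over an interval is the number of bars containing it
(`Barcode.rk_eq`). So the maximal intervals are exactly the inclusion-maximal bars, and the rank
there is the multiplicity of the bar. A point where the module is nonzero lies in a bar, hence in a
maximal one, and the copies of that bar span a summand that can be peeled off. The delicate point is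
that the procedure may choose a different summand `N` isomorphic to that power. By
`Barcode.disjoint_span`, `N` meets the span of the other bars trivially: passing from `N` to another
bar and back gives an endomorphism of `N` that vanishes at some point of the interval, hence
everywhere by connectedness. A dimension count then shows that the other bars form a barcode of the
quotient (`Barcode.quotient`). By induction, each stage has as its barcode the original bars not yet
output (`TrueIntervalRun.barcode_stage`). Distinctness, the bound by the number of bars, the
multiplicity formula and the final isomorphism all follow by counting bars. -/

theorem PosetInterval.carrier_injective {P : Type w} [PartialOrder P] :
    Function.Injective (PosetInterval.carrier (P := P)) := by
  rintro ⟨_, _, _, _⟩ ⟨_, _, _, _⟩ rfl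
  rfl

namespace PersistenceModule

variable {𝔽 : Type u} [Field 𝔽] {P : Type w} [PartialOrder P]

/-! ### Barcodes: transport, isomorphisms, interval modules and direct sums -/

/-- A pointwise basis of `M` that exhibits `M` as the direct sum of the interval modules
of the family `I`. -/
structure Barcode (M : PersistenceModule.{u, v, w} 𝔽 P) {J : Type y}
    (I : J → PosetInterval P) where
  basis : ∀ p, Basis {j // p ∈ (I j).carrier} 𝔽 (M.obj p)
  map_mem : ∀ {p q : P} (h : p ≤ q) (j : J) (hp : p ∈ (I j).carrier) (hq : q ∈ (I j).carrier),
    M.map h (basis p ⟨j, hp⟩) = basis q ⟨j, hq⟩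
  map_notMem : ∀ {p q : P} (h : p ≤ q) (j : J) (hp : p ∈ (I j).carrier),
    q ∉ (I j).carrier → M.map h (basis p ⟨j, hp⟩) = 0

namespace Barcode

variable {M : PersistenceModule.{u, v, w} 𝔽 P} {J : Type y} {I : J → PosetInterval P}

/-- Transport of a barcode along an isomorphism. -/
def ofIso {N : PersistenceModule.{u, x, w} 𝔽 P} (B : Barcode N I) (e : Iso M N) :
    Barcode M I where
  basis p := (B.basis p).map (e.equiv p).symm
  map_mem {p q} h j hp hq := by
    apply (e.equiv q).injective
    simp [e.naturality, B.map_mem h j hp hq]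
  map_notMem {p q} h j hp hq := by
    apply (e.equiv q).injective
    simp [e.naturality, B.map_notMem h j hp hq]

/-- Change of the index type of a barcode. -/
def reindex {J' : Type*} {I' : J' → PosetInterval P} (B : Barcode M I) (e : J ≃ J')
    (he : ∀ j, I' (e j) = I j) : Barcode M I' where
  basis p := (B.basis p).reindex (e.subtypeEquiv fun j => by rw [he])
  map_mem {p q} h j hp hq := by
    obtain ⟨j, rfl⟩ := e.surjective j
    simpa [Basis.reindex_apply] using
      B.map_mem h j (by simpa [he] using hp) (by simpa [he] using hq)
  map_notMem {p q} h j hp hq := by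
    obtain ⟨j, rfl⟩ := e.surjective j
    simpa [Basis.reindex_apply] using
      B.map_notMem h j (by simpa [he] using hp) (by simpa [he] using hq)

/-- Modules with the same barcode are isomorphic. -/
def iso {N : PersistenceModule.{u, x, w} 𝔽 P} (B : Barcode M I) (C : Barcode N I) :
    Iso M N where
  equiv p := (B.basis p).equiv (C.basis p) (Equiv.refl _)
  naturality {p q} h a := by
    have key : ((B.basis q).equiv (C.basis q) (Equiv.refl _)).toLinearMap ∘ₗ M.map h =
        N.map h ∘ₗ ((B.basis p).equiv (C.basis p) (Equiv.refl _)).toLinearMap := by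
      refine (B.basis p).ext fun ⟨j, hp⟩ => ?_
      by_cases hq : q ∈ (I j).carrier
      · simp [B.map_mem h j hp hq, C.map_mem h j hp hq]
      · simp [B.map_notMem h j hp hq, C.map_notMem h j hp hq]
    exact LinearMap.congr_fun key a

/-- The basis of the space of an interval module at a point. -/
def intervalBasis (I : PosetInterval P) (p : P) :
    Basis {_j : Unit // p ∈ I.carrier} 𝔽 (PLift (p ∈ I.carrier) → 𝔽) :=
  open Classical in
  (Pi.basisFun 𝔽 (PLift (p ∈ I.carrier))).reindex
    ⟨fun h => ⟨(), h.down⟩, fun h => ⟨h.2⟩, fun _ => rfl, fun _ => rfl⟩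

theorem intervalBasis_apply (I : PosetInterval P) (p : P) (j : {_j : Unit // p ∈ I.carrier}) :
    (intervalBasis I p j : PLift (p ∈ I.carrier) → 𝔽) = 1 := by
  funext ⟨hp⟩
  simp [intervalBasis]

/-- The barcode of an interval module. -/
def intervalModule (I : PosetInterval P) :
    Barcode (PersistenceModule.intervalModule 𝔽 I) fun _ : Unit => I where
  basis p := intervalBasis I p
  map_mem {p q} h j hp hq := by
    funext ⟨hq'⟩
    refine (dif_pos hp).trans ?_
    exact (congrFun (intervalBasis_apply I p ⟨j, hp⟩) _).trans
      (congrFun (intervalBasis_apply I q ⟨j, hq⟩) _).symm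
  map_notMem {p q} h j hp hq := by
    funext ⟨hq'⟩
    exact absurd hq' hq

section DirectSum

variable {L : Type x} {K : L → Type y} {M : L → PersistenceModule.{u, v, w} 𝔽 P}
  {I : ∀ l, K l → PosetInterval P}

open Classical in
/-- The basis of the space of a direct sum at a point. -/
def directSumBasis (B : ∀ l, Barcode (M l) (I l)) (p : P) :
    Basis {a : Σ l, K l // p ∈ (I a.1 a.2).carrier} 𝔽 (DirectSum L fun l => (M l).obj p) :=
  (DFinsupp.basis fun l => (B l).basis p).reindex
    ⟨fun a => ⟨⟨a.1, a.2.1⟩, a.2.2⟩, fun a => ⟨a.1.1, ⟨a.1.2, a.2⟩⟩, fun _ => rfl, fun _ => rfl⟩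

theorem directSumBasis_repr (B : ∀ l, Barcode (M l) (I l)) (p : P)
    (z : DirectSum L fun l => (M l).obj p)
    (a : {a : Σ l, K l // p ∈ (I a.1 a.2).carrier}) :
    (directSumBasis B p).repr z a = ((B a.1.1).basis p).repr (z a.1.1) ⟨a.1.2, a.2⟩ := by
  classical
  rfl

open Classical in
theorem directSumBasis_apply (B : ∀ l, Barcode (M l) (I l)) (p : P)
    (a : {a : Σ l, K l // p ∈ (I a.1 a.2).carrier}) :
    directSumBasis B p a =
      DirectSum.lof 𝔽 L (fun l => (M l).obj p) a.1.1 ((B a.1.1).basis p ⟨a.1.2, a.2⟩) := by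
  apply (directSumBasis B p).repr.injective
  obtain ⟨⟨l, k⟩, hk⟩ := a
  ext ⟨⟨l', k'⟩, hk'⟩
  rw [Basis.repr_self, directSumBasis_repr, DirectSum.lof_eq_of]
  by_cases h : l = l'
  · subst h
    simp [DirectSum.of_eq_same, Finsupp.single_apply]
  · rw [DirectSum.of_eq_of_ne _ _ _ (Ne.symm h), map_zero, Finsupp.single_eq_of_ne]
    · rfl
    · simp [Ne.symm h]

/-- The barcode of a direct sum. -/
def directSum (B : ∀ l, Barcode (M l) (I l)) :
    Barcode (PersistenceModule.directSum M) fun a : Σ l, K l => I a.1 a.2 where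
  basis p := directSumBasis B p
  map_mem {p q} h j hp hq := by
    classical
    refine (congrArg (DirectSum.lmap fun l => (M l).map h) (directSumBasis_apply B p _)).trans ?_
    rw [DirectSum.lmap_lof, (B j.1).map_mem h j.2 hp hq]
    exact (directSumBasis_apply B q ⟨j, hq⟩).symm
  map_notMem {p q} h j hp hq := by
    classical
    refine (congrArg (DirectSum.lmap fun l => (M l).map h) (directSumBasis_apply B p _)).trans ?_
    rw [DirectSum.lmap_lof, (B j.1).map_notMem h j.2 hp hq, map_zero]
    rfl

end DirectSum

end Barcode
-- The universal property of the colimit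
open Classical in
/-- The map out of the colimit induced by a compatible family of linear maps. -/
def colimitDesc (M : PersistenceModule.{u, v, w} 𝔽 P) {W : Type x} [AddCommGroup W] [Module 𝔽 W]
    (f : ∀ p, M.obj p →ₗ[𝔽] W)
    (hf : ∀ (p q : P) (h : p ≤ q) (a : M.obj p), f q (M.map h a) = f p a) :
    M.colimit →ₗ[𝔽] W :=
  M.colimitRelations.liftQ (DirectSum.toModule 𝔽 P W f) <| by
    refine Submodule.span_le.2 ?_
    rintro _ ⟨p, q, h, a, rfl⟩
    rw [SetLike.mem_coe, LinearMap.mem_ker, map_sub, sub_eq_zero, DirectSum.toModule_lof,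
      DirectSum.toModule_lof, hf]

theorem colimitDesc_inj (M : PersistenceModule.{u, v, w} 𝔽 P) {W : Type x} [AddCommGroup W]
    [Module 𝔽 W] (f : ∀ p, M.obj p →ₗ[𝔽] W)
    (hf : ∀ (p q : P) (h : p ≤ q) (a : M.obj p), f q (M.map h a) = f p a) (p : P)
    (a : M.obj p) : M.colimitDesc f hf (M.colimitInj p a) = f p a := by
  classical
  exact (Submodule.liftQ_apply _ _ _).trans (DirectSum.toModule_lof _ _ _)

namespace Barcode

variable {M : PersistenceModule.{u, v, w} 𝔽 P} {J : Type y} {I : J → PosetInterval P}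

/-! ### Dimensions and finiteness of barcodes -/

theorem finrank_obj [Finite J] (B : Barcode M I) (p : P) :
    finrank 𝔽 (M.obj p) = Nat.card {j // p ∈ (I j).carrier} :=
  finrank_eq_nat_card_basis (B.basis p)

theorem dim_ne_zero_iff [Finite J] (B : Barcode M I) (p : P) :
    M.dim p ≠ 0 ↔ ∃ j, p ∈ (I j).carrier := by
  rw [dim, B.finrank_obj, Nat.card_ne_zero]
  simp [Subtype.finite]

/-- A family of intervals decomposing a pointwise finite-dimensional module is finite. -/
theorem finite_index [Finite P] (B : Barcode M I) (hM : ∀ p, Module.Finite 𝔽 (M.obj p)) :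
    Finite J := by
  have (p : P) : Finite {j // p ∈ (I j).carrier} :=
    haveI := hM p
    Module.Finite.finite_basis (B.basis p)
  -- Each bar yields a basis vector at a point chosen in it, so the bars embed into the finite
  -- disjoint union of the basis index sets.
  choose f hf using fun j => (I j).nonempty
  exact Finite.of_injective (fun j => (⟨f j, j, hf j⟩ : Σ p, {j // p ∈ (I j).carrier}))
    fun a b h => by
      have : ∀ {s t : Σ p, {j // p ∈ (I j).carrier}}, s = t → s.2.1 = t.2.1 := by
        rintro _ _ rfl; rfl
      exact this h

/-! ### Projections and coordinates along single bars -/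

open Classical in
/-- The projection of `M` onto the `j`-th summand, at the point `p`. -/
def proj (B : Barcode M I) (j : J) (p : P) : M.obj p →ₗ[𝔽] M.obj p :=
  (B.basis p).constr 𝔽 fun i => if i.1 = j then B.basis p i else 0

theorem proj_basis_self (B : Barcode M I) (j : J) (p : P) (hp : p ∈ (I j).carrier) :
    B.proj j p (B.basis p ⟨j, hp⟩) = B.basis p ⟨j, hp⟩ := by
  simp [proj]

theorem proj_basis_ne (B : Barcode M I) {j : J} {p : P} (i : {j // p ∈ (I j).carrier})
    (h : i.1 ≠ j) : B.proj j p (B.basis p i) = 0 := by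
  simp [proj, h]

theorem map_proj (B : Barcode M I) (j : J) {p q : P} (h : p ≤ q) (a : M.obj p) :
    M.map h (B.proj j p a) = B.proj j q (M.map h a) := by
  have key : M.map h ∘ₗ B.proj j p = B.proj j q ∘ₗ M.map h := by
    refine (B.basis p).ext fun ⟨i, hp⟩ => ?_
    by_cases hij : i = j
    · subst hij
      by_cases hq : q ∈ (I i).carrier
      · simp [B.map_mem h i hp hq, proj_basis_self]
      · simp [B.map_notMem h i hp hq, proj_basis_self]
    · by_cases hq : q ∈ (I i).carrier
      · simp [B.map_mem h i hp hq, B.proj_basis_ne ⟨i, _⟩ hij]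
      · simp [B.map_notMem h i hp hq, B.proj_basis_ne ⟨i, _⟩ hij]
  exact LinearMap.congr_fun key a

theorem proj_eq_zero (B : Barcode M I) {j : J} {p : P} (hp : p ∉ (I j).carrier) :
    B.proj j p = 0 :=
  (B.basis p).ext fun i => B.proj_basis_ne i fun h => hp (h ▸ i.2)

theorem proj_eq_smul (B : Barcode M I) {j : J} {p : P} (hp : p ∈ (I j).carrier) (a : M.obj p) :
    B.proj j p a = (B.basis p).coord ⟨j, hp⟩ a • B.basis p ⟨j, hp⟩ := by
  have key : B.proj j p = ((B.basis p).coord ⟨j, hp⟩).smulRight (B.basis p ⟨j, hp⟩) := by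
    refine (B.basis p).ext fun ⟨i, hi⟩ => ?_
    by_cases hij : i = j
    · subst hij
      simp [proj_basis_self]
    · simp [B.proj_basis_ne ⟨i, hi⟩ hij, hij]
  exact LinearMap.congr_fun key a

theorem sum_proj [Fintype J] (B : Barcode M I) (p : P) (a : M.obj p) :
    ∑ j, B.proj j p a = a := by
  have key : ∑ j, B.proj j p = LinearMap.id := by
    refine (B.basis p).ext fun ⟨i, hi⟩ => ?_
    rw [LinearMap.sum_apply, Finset.sum_eq_single i _ (by simp)]
    · simp [proj_basis_self]
    · intro j _ hj
      exact B.proj_basis_ne ⟨i, hi⟩ hj.symm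
  simpa using LinearMap.congr_fun key a

/-- This compatibility lets the coordinate along a bar descend to a functional on the colimit over
any interval inside that bar. -/
theorem coord_map (B : Barcode M I) {j : J} {p q : P} (h : p ≤ q) (hp : p ∈ (I j).carrier)
    (hq : q ∈ (I j).carrier) (a : M.obj p) :
    (B.basis q).coord ⟨j, hq⟩ (M.map h a) = (B.basis p).coord ⟨j, hp⟩ a := by
  have key : (B.basis q).coord ⟨j, hq⟩ ∘ₗ M.map h = (B.basis p).coord ⟨j, hp⟩ := by
    refine (B.basis p).ext fun ⟨i, hi⟩ => ?_
    by_cases hij : i = j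
    · subst hij
      simp [B.map_mem h i hp hq]
    · by_cases hqi : q ∈ (I i).carrier
      · simp [B.map_mem h i hi hqi, Ne.symm hij]
      · simp [B.map_notMem h i hi hqi, Ne.symm hij]
  exact LinearMap.congr_fun key a

/-! ### The generalized rank -/

/-- Each bar containing `I₀` gives a section made of its basis vectors. Their colimit classes are
independent because the coordinate functionals separate them. They span the range because every
section is the sum of its components along the bars, and a component along a bar not containing `I₀`
dies in the colimit. -/
theorem rk_eq [Finite J] (B : Barcode M I) (I₀ : PosetInterval P) :
    M.rk I₀ = Nat.card {j // I₀.carrier ⊆ (I j).carrier} := by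
  have := Fintype.ofFinite J
  have : Nonempty I₀.carrier := I₀.nonempty.to_subtype
  let R := M.restrict I₀.carrier
  let q₀ : I₀.carrier := Classical.arbitrary I₀.carrier
  let σ (j : {j // I₀.carrier ⊆ (I j).carrier}) : R.limit :=
    ⟨fun q => B.basis q ⟨j, j.2 q.2⟩, fun p q h => B.map_mem _ _ _ _⟩
  let E (j : J) (s : R.limit) : R.limit :=
    ⟨fun q => B.proj j q (s.1 q), fun p q h =>
      (B.map_proj j _ _).trans (congrArg (B.proj j q) (s.2 p q h))⟩
  let c (j : {j // I₀.carrier ⊆ (I j).carrier}) : R.colimit →ₗ[𝔽] 𝔽 :=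
    R.colimitDesc (fun q => (B.basis q).coord ⟨j, j.2 q.2⟩) fun p q h a => B.coord_map _ _ _ a
  have hc (i j) : c i (R.limitToColimit q₀ (σ j)) = (B.basis q₀.1).coord ⟨i, i.2 q₀.2⟩
      (B.basis q₀.1 ⟨j, j.2 q₀.2⟩) :=
    R.colimitDesc_inj _ _ _ _
  have hli : LinearIndependent 𝔽 fun j => R.limitToColimit q₀ (σ j) := by
    refine LinearIndependent.of_pairwise_dual_eq_zero_one _ c (fun i j hij => ?_) fun i => ?_
    · have : (i : J) ≠ j := fun h => hij (Subtype.ext h)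
      exact (hc i j).trans (by simp [this])
    · exact (hc i i).trans (by simp)
  have hspan : Submodule.span 𝔽 (Set.range fun j => R.limitToColimit q₀ (σ j)) =
      LinearMap.range (R.limitToColimit q₀) := by
    apply le_antisymm
    · rw [Submodule.span_le]
      rintro _ ⟨j, rfl⟩
      exact ⟨_, rfl⟩
    · rintro _ ⟨s, rfl⟩
      have hs : s = ∑ j, E j s := by
        ext q
        rw [AddSubmonoidClass.coe_finsetSum, Finset.sum_apply]
        exact (B.sum_proj q.1 (s.1 q)).symm
      rw [hs, map_sum]
      refine Submodule.sum_mem _ fun j _ => ?_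
      by_cases hj : I₀.carrier ⊆ (I j).carrier
      · have : R.limitToColimit q₀ (E j s) =
            (B.basis q₀.1).coord ⟨j, hj q₀.2⟩ (s.1 q₀) • R.limitToColimit q₀ (σ ⟨j, hj⟩) :=
          (congrArg (R.colimitInj q₀) (B.proj_eq_smul (hj q₀.2) (s.1 q₀))).trans (map_smul _ _ _)
        rw [this]
        exact Submodule.smul_mem _ _ (Submodule.subset_span ⟨⟨j, hj⟩, rfl⟩)
      · obtain ⟨q, hq, hqj⟩ := Set.not_subset.1 hj
        -- Connectedness allows moving from `q₀` to `q`, a point outside the bar, where the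
        -- component vanishes.
        rw [limitToColimit_eq I₀.connected R q₀ ⟨q, hq⟩]
        have : (E j s).1 ⟨q, hq⟩ = 0 := LinearMap.congr_fun (B.proj_eq_zero hqj) _
        have h0 : R.limitToColimit ⟨q, hq⟩ (E j s) = 0 :=
          (congrArg (R.colimitInj ⟨q, hq⟩) this).trans (map_zero _)
        rw [h0]
        exact Submodule.zero_mem _
  have := Fintype.ofFinite {j // I₀.carrier ⊆ (I j).carrier}
  rw [Nat.card_eq_fintype_card, ← finrank_span_eq_card hli, hspan]
  rfl

/-! ### Maximal intervals -/

theorem rk_pos_iff [Finite J] (B : Barcode M I) (I₀ : PosetInterval P) :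
    0 < M.rk I₀ ↔ ∃ j, I₀.carrier ⊆ (I j).carrier := by
  rw [B.rk_eq, Nat.card_pos_iff]
  simp [Subtype.finite]

/-- Every bar has positive rank, so maximality of `I₀` rules out a bar strictly containing it. -/
theorem subset_iff_of_isMaximalInterval [Finite J] (B : Barcode M I) {I₀ : PosetInterval P}
    (h : M.IsMaximalInterval I₀) (j : J) : I₀.carrier ⊆ (I j).carrier ↔ I j = I₀ := by
  refine ⟨fun hj => ?_, fun hj => hj ▸ subset_rfl⟩
  by_contra hne
  have h1 := h.2 (I j) (hj.ssubset_of_ne fun e => hne (PosetInterval.carrier_injective e.symm))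
  exact ((B.rk_pos_iff (I j)).2 ⟨j, subset_rfl⟩).ne' h1

theorem rk_of_isMaximalInterval [Finite J] (B : Barcode M I) {I₀ : PosetInterval P}
    (h : M.IsMaximalInterval I₀) : M.rk I₀ = Nat.card {j // I j = I₀} := by
  rw [B.rk_eq]
  exact Nat.card_congr (Equiv.subtypeEquivRight (B.subset_iff_of_isMaximalInterval h))

/-- An inclusion-maximal bar above the given one works: any interval of positive rank lies in some
bar, so it cannot be strictly larger. -/
theorem exists_isMaximalInterval [Finite J] (B : Barcode M I) (j : J) :
    ∃ I₀, M.IsMaximalInterval I₀ ∧ (I j).carrier ⊆ I₀.carrier := by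
  obtain ⟨_, hle, ⟨⟨i, rfl⟩, hmax⟩⟩ :=
    (Set.finite_range fun i => (I i).carrier).exists_le_maximal (Set.mem_range_self j)
  refine ⟨I i, ⟨(B.rk_pos_iff _).2 ⟨i, subset_rfl⟩, fun K hK => ?_⟩, hle⟩
  by_contra hne
  obtain ⟨l, hl⟩ := (B.rk_pos_iff K).1 (Nat.pos_of_ne_zero hne)
  exact hK.2 (hl.trans (hmax ⟨l, rfl⟩ (hK.1.trans hl)))

/-! ### Splitting off summands -/

/-- The barcode of a power of an interval module. -/
def intervalPower (I₀ : PosetInterval P) (m : ℕ) :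
    Barcode (PersistenceModule.intervalPower 𝔽 I₀ m) fun _ : Fin m => I₀ :=
  (Barcode.directSum fun _ : Fin m => Barcode.intervalModule (𝔽 := 𝔽) I₀).reindex
    (Equiv.sigmaPUnit _) fun _ => rfl

/-- If all intervals of the barcode are equal to `I₀`, then an endomorphism that vanishes at
a point of `I₀` is zero. -/
theorem endomorphism_eq_zero {I₀ : PosetInterval P} (B : Barcode M fun _ : J => I₀)
    (f : ∀ p, M.obj p →ₗ[𝔽] M.obj p)
    (hf : ∀ {p q : P} (h : p ≤ q) (a : M.obj p), f q (M.map h a) = M.map h (f p a))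
    {q : P} (hq : q ∈ I₀.carrier) (h0 : f q = 0) (p : P) : f p = 0 := by
  by_cases hp : p ∈ I₀.carrier
  swap
  · exact (B.basis p).ext fun j => absurd j.2 hp
  -- Inside `I₀` the structure maps carry basis to basis. Hence vanishing of `f` spreads upwards by
  -- surjectivity and downwards by injectivity, along a chain of comparable points from `q`.
  have hbij {a b : P} (h : a ≤ b) (ha : a ∈ I₀.carrier) (hb : b ∈ I₀.carrier) :
      Function.Bijective (M.map h) := by
    have : M.map h = ((B.basis a).equiv (B.basis b)
        ⟨fun j => ⟨j.1, hb⟩, fun j => ⟨j.1, ha⟩, fun _ => rfl, fun _ => rfl⟩).toLinearMap :=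
      (B.basis a).ext fun j => by
        rw [LinearEquiv.coe_coe, Basis.equiv_apply]
        exact B.map_mem h j.1 ha hb
    rw [this]
    exact LinearEquiv.bijective _
  have key (a : I₀.carrier)
      (ha : Relation.ReflTransGen (fun a b : I₀.carrier => a ≤ b ∨ b ≤ a) ⟨q, hq⟩ a) :
      f a = 0 := by
    induction ha with
    | refl => exact h0
    | @tail a b _ hab ih =>
      rcases hab with hab | hab
      · ext x
        obtain ⟨y, rfl⟩ := (hbij hab a.2 b.2).2 x
        rw [hf, ih, LinearMap.zero_apply, map_zero, LinearMap.zero_apply]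
      · ext x
        apply (hbij hab b.2 a.2).1
        rw [← hf, ih, LinearMap.zero_apply, LinearMap.zero_apply, map_zero]
  exact key ⟨p, hp⟩ (I₀.connected _ _)

/-- The submodule spanned by some of the summands. -/
def span (B : Barcode M I) (S : Set J) : Sub M where
  space p := Submodule.span 𝔽 (B.basis p '' {j | j.1 ∈ S})
  map_mem {p q} h a ha := by
    suffices Submodule.span 𝔽 (B.basis p '' {j | j.1 ∈ S}) ≤
        (Submodule.span 𝔽 (B.basis q '' {j | j.1 ∈ S})).comap (M.map h) from this ha
    rw [Submodule.span_le]
    rintro _ ⟨⟨j, hj⟩, hjS, rfl⟩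
    by_cases hq : q ∈ (I j).carrier
    · rw [SetLike.mem_coe, Submodule.mem_comap, B.map_mem h j hj hq]
      exact Submodule.subset_span ⟨⟨j, hq⟩, hjS, rfl⟩
    · rw [SetLike.mem_coe, Submodule.mem_comap, B.map_notMem h j hj hq]
      exact Submodule.zero_mem _

theorem span_isSummand (B : Barcode M I) (S : Set J) : (B.span S).IsSummand := by
  refine ⟨B.span Sᶜ, fun p => ⟨?_, ?_⟩⟩
  · refine (B.basis p).linearIndependent.disjoint_span_image ?_
    exact Set.disjoint_left.2 fun j hj hj' => hj' hj
  · rw [codisjoint_iff, span, span, ← Submodule.span_union, ← Set.image_union]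
    convert (B.basis p).span_eq
    rw [← Set.image_univ]
    congr 1
    ext j
    simp [em]

/-- The basis at a point of the submodule spanned by some of the summands. -/
def spanBasis (B : Barcode M I) (S : Set J) (p : P) :
    Basis {j : S // p ∈ (I j).carrier} 𝔽 ((B.span S).space p) :=
  let v : {j : S // p ∈ (I j).carrier} → M.obj p := fun j => B.basis p ⟨j.1, j.2⟩
  (Basis.span (v := v) ((B.basis p).linearIndependent.comp
    (fun j : {j : S // p ∈ (I j).carrier} => ⟨j.1, j.2⟩) fun i j h => by
      simpa [Subtype.ext_iff] using h)).map
    (LinearEquiv.ofEq _ _ <|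
      show Submodule.span 𝔽 (Set.range v) = (B.span S).space p from
        congrArg (Submodule.span 𝔽) <| by
          ext a
          constructor
          · rintro ⟨j, rfl⟩
            exact ⟨⟨j.1, j.2⟩, j.1.2, rfl⟩
          · rintro ⟨⟨j, hj⟩, hjS, rfl⟩
            exact ⟨⟨⟨j, hjS⟩, hj⟩, rfl⟩)

theorem coe_spanBasis (B : Barcode M I) (S : Set J) (p : P)
    (j : {j : S // p ∈ (I j).carrier}) :
    (B.spanBasis S p j : M.obj p) = B.basis p ⟨j.1, j.2⟩ := by
  rw [spanBasis, Basis.map_apply, LinearEquiv.coe_ofEq_apply, Basis.span_apply]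

/-- The barcode of the submodule spanned by some of the summands. -/
def ofSpan (B : Barcode M I) (S : Set J) :
    Barcode (B.span S).toModule fun j : S => I j where
  basis p := B.spanBasis S p
  map_mem {p q} h j hp hq := Subtype.ext <|
    (congrArg (M.map h) (B.coe_spanBasis S p ⟨j, hp⟩)).trans <|
      (B.map_mem h j hp hq).trans (B.coe_spanBasis S q ⟨j, hq⟩).symm
  map_notMem {p _} h j hp hq := Subtype.ext <|
    (congrArg (M.map h) (B.coe_spanBasis S p ⟨j, hp⟩)).trans (B.map_notMem h j hp hq)

/-- The span of all bars equal to `I₀` serves, since by maximality their number is the rank. -/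
theorem exists_isPeelable [Finite J] (B : Barcode M I) {I₀ : PosetInterval P}
    (h : M.IsMaximalInterval I₀) : ∃ N, M.IsPeelable I₀ N := by
  refine ⟨B.span {j | I j = I₀}, B.span_isSummand _, ?_⟩
  rw [B.rk_of_isMaximalInterval h]
  exact ⟨((B.ofSpan {j | I j = I₀}).reindex (Finite.equivFin {j // I j = I₀})
    fun j => j.2.symm).iso (intervalPower I₀ _)⟩

/-! ### Quotients by an arbitrary peelable summand -/

/-- The projections that belong to complementary submodules are natural. -/
theorem map_projection {N N' : Sub M} (hc : ∀ p, IsCompl (N.space p) (N'.space p)) {p q : P}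
    (h : p ≤ q) (a : M.obj p) :
    M.map h ((N.space p).projection (N'.space p) (hc p) a) =
      (N.space q).projection (N'.space q) (hc q) (M.map h a) := by
  set π := (N.space p).projection (N'.space p) (hc p)
  -- The difference lies in the complement, which the structure map preserves, so the projection at
  -- `q` kills its image.
  have h1 : a - π a ∈ N'.space p := by
    rw [← Submodule.projection_apply_eq_zero_iff (hc p), map_sub,
      Submodule.projection_apply_of_mem_left (hc p) (Submodule.projection_apply_mem (hc p) a),
      sub_self]
  have h2 := (Submodule.projection_apply_eq_zero_iff (hc q)).2 (N'.map_mem h _ h1)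
  rw [map_sub, map_sub, sub_eq_zero] at h2
  rw [h2]
  exact (Submodule.projection_apply_of_mem_left (hc q)
    (N.map_mem h _ (Submodule.projection_apply_mem (hc p) a))).symm

/-- A summand isomorphic to a power of `I₀` meets the span of the summands whose intervals do not
contain `I₀` trivially. -/
theorem disjoint_span [Finite J] (B : Barcode M I) {I₀ : PosetInterval P} {N : Sub M}
    (hN : N.IsSummand) {K : Type x} (C : Barcode N.toModule fun _ : K => I₀) (p : P) :
    Disjoint ((B.span {j | ¬ I₀.carrier ⊆ (I j).carrier}).space p) (N.space p) := by
  have := Fintype.ofFinite J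
  obtain ⟨N', hc⟩ := hN
  -- The composite of the inclusion of `N`, the projection to bar `j` and the projection back to `N`
  -- is an endomorphism of `N`. It vanishes at a point of `I₀` outside bar `j`, hence everywhere.
  have hz (j : J) (hj : ¬ I₀.carrier ⊆ (I j).carrier) (x : N.space p) :
      (N.space p).projection (N'.space p) (hc p) (B.proj j p x) = 0 := by
    obtain ⟨q, hq, hqj⟩ := Set.not_subset.1 hj
    let f (p : P) : N.space p →ₗ[𝔽] N.space p :=
      (N.space p).projectionOnto (N'.space p) (hc p) ∘ₗ B.proj j p ∘ₗ (N.space p).subtype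
    have h0 : f q = 0 := by
      simp [f, B.proj_eq_zero hqj]
    have hf : f p = 0 := C.endomorphism_eq_zero f
      (fun {p q} h (a : N.space p) => Subtype.ext <|
        (congrArg ((N.space q).projection (N'.space q) (hc q)) (B.map_proj j h a.1)).symm.trans
          (map_projection hc h _).symm) hq h0 p
    exact congrArg Subtype.val (LinearMap.congr_fun hf x)
  rw [Submodule.disjoint_def]
  intro x hx hxN
  have hx0 (j : J) (hj : I₀.carrier ⊆ (I j).carrier) : B.proj j p x = 0 := by
    have : (B.span {j | ¬ I₀.carrier ⊆ (I j).carrier}).space p ≤ LinearMap.ker (B.proj j p) := by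
      refine Submodule.span_le.2 ?_
      rintro _ ⟨i, hi, rfl⟩
      exact B.proj_basis_ne i fun e => hi (e ▸ hj)
    exact this hx
  -- As `x` lies in `N`, it equals the sum over the bars of the projections to `N` of its
  -- components. Bars containing `I₀` contribute nothing by `hx0`, the others nothing by `hz`.
  rw [← Submodule.projection_apply_of_mem_left (hc p) hxN, ← B.sum_proj p x, map_sum]
  refine Finset.sum_eq_zero fun j _ => ?_
  by_cases hj : I₀.carrier ⊆ (I j).carrier
  · rw [hx0 j hj, map_zero]
  · exact hz j hj ⟨x, hxN⟩

/-- The dimension of `N` at `p` is the number of bars through `p` equal to `I₀`, although `N` need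
not be spanned by these bars. -/
theorem finrank_quotient [Finite J] (B : Barcode M I) {I₀ : PosetInterval P}
    (h : M.IsMaximalInterval I₀) {N : Sub M}
    (C : Barcode N.toModule fun _ : Fin (M.rk I₀) => I₀) (p : P) :
    finrank 𝔽 (M.obj p ⧸ N.space p) =
      Nat.card {j : {j // I j ≠ I₀} // p ∈ (I j).carrier} := by
  have : Module.Finite 𝔽 (M.obj p) := Module.Finite.of_basis (B.basis p)
  have h1 := (N.space p).finrank_quotient_add_finrank
  have h2 : finrank 𝔽 (N.space p) = Nat.card {j : {j // I j = I₀} // p ∈ (I j).carrier} := by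
    refine (C.finrank_obj p).trans ?_
    rw [B.rk_of_isMaximalInterval h]
    exact Nat.card_congr ((Finite.equivFin {j // I j = I₀}).symm.subtypeEquiv fun a => by
      rw [((Finite.equivFin {j // I j = I₀}).symm a).2])
  have h3 : Nat.card {j // p ∈ (I j).carrier} =
      Nat.card {j : {j // I j = I₀} // p ∈ (I j).carrier} +
        Nat.card {j : {j // I j ≠ I₀} // p ∈ (I j).carrier} := by
    classical
    rw [← Nat.card_sum]
    exact Nat.card_congr <|
      (Equiv.sumCompl fun j : {j // p ∈ (I j).carrier} => I j = I₀).symm.trans <|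
        Equiv.sumCongr
          (Equiv.subtypeSubtypeEquivSubtypeInter _ (fun j => I j = I₀) |>.trans
            ((Equiv.subtypeEquivRight fun _ => and_comm).trans
              (Equiv.subtypeSubtypeEquivSubtypeInter _ fun j => p ∈ (I j).carrier).symm))
          (Equiv.subtypeSubtypeEquivSubtypeInter _ (fun j => I j ≠ I₀) |>.trans
            ((Equiv.subtypeEquivRight fun _ => and_comm).trans
              (Equiv.subtypeSubtypeEquivSubtypeInter _ fun j => p ∈ (I j).carrier).symm))
  have h4 := B.finrank_obj p
  omega

/-- Peeling off a maximal interval removes its copies from the barcode. -/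
theorem quotient [Finite J] (B : Barcode M I) {I₀ : PosetInterval P}
    (h : M.IsMaximalInterval I₀) {N : Sub M} (hN : M.IsPeelable I₀ N) :
    Nonempty (Barcode (M.quotient N) fun j : {j // I j ≠ I₀} => I j) := by
  obtain ⟨hs, ⟨e⟩⟩ := hN
  have C := (intervalPower (𝔽 := 𝔽) I₀ (M.rk I₀)).ofIso e
  let v (p : P) (j : {j : {j // I j ≠ I₀} // p ∈ (I j).carrier}) : M.obj p :=
    B.basis p ⟨j.1, j.2⟩
  -- By maximality, a bar different from `I₀` does not contain `I₀`, so `disjoint_span` keeps these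
  -- basis vectors independent modulo `N`.
  have hli (p : P) : LinearIndependent 𝔽 ((N.space p).mkQ ∘ v p) := by
    refine LinearIndependent.map ((B.basis p).linearIndependent.comp _ fun i j hij => ?_) ?_
    · simpa [Subtype.ext_iff] using hij
    · rw [Submodule.ker_mkQ]
      refine (B.disjoint_span hs C p).mono_left (Submodule.span_mono ?_)
      rintro _ ⟨j, rfl⟩
      exact ⟨⟨j.1, j.2⟩, fun hj => j.1.2 ((B.subset_iff_of_isMaximalInterval h _).1 hj), rfl⟩
  -- Independence together with the right cardinality replaces a direct proof of spanning.
  have hspan (p : P) : Submodule.span 𝔽 (Set.range ((N.space p).mkQ ∘ v p)) = ⊤ := by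
    have : Module.Finite 𝔽 (M.obj p) := Module.Finite.of_basis (B.basis p)
    have := Fintype.ofFinite {j : {j // I j ≠ I₀} // p ∈ (I j).carrier}
    refine (hli p).span_eq_top_of_card_eq_finrank' ?_
    rw [B.finrank_quotient h C p, Nat.card_eq_fintype_card]
  have hb (p : P) (j : {j : {j // I j ≠ I₀} // p ∈ (I j).carrier}) :
      Basis.mk (hli p) (hspan p).ge j = (N.space p).mkQ (B.basis p ⟨j.1, j.2⟩) :=
    Basis.mk_apply _ _ _
  refine ⟨fun p => Basis.mk (hli p) (hspan p).ge, fun {p q} hpq j hp hq => ?_,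
    fun {p q} hpq j hp hq => ?_⟩
  · refine (congrArg ((M.quotient N).map hpq) (hb p ⟨j, hp⟩)).trans ?_
    exact (congrArg (N.space q).mkQ (B.map_mem hpq j hp hq)).trans (hb q ⟨j, hq⟩).symm
  · refine (congrArg ((M.quotient N).map hpq) (hb p ⟨j, hp⟩)).trans ?_
    exact (congrArg (N.space q).mkQ (B.map_notMem hpq j hp hq)).trans (map_zero _)

end Barcode

/-! ### Executions of the procedure -/

namespace TrueIntervalRun

variable {M : PersistenceModule.{u, v, w} 𝔽 P} {J : Type y} {I : J → PosetInterval P} {k : ℕ}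

/-- The summands that are left after `i` iterations are those whose intervals have not been
output. -/
theorem barcode_stage [Finite J] (B : Barcode M I) (r : TrueIntervalRun M k) (i : Fin (k + 1)) :
    Nonempty (Barcode (r.stage i)
      fun j : {j // ∀ l : Fin k, l.castSucc < i → I j ≠ r.interval l} => I j) := by
  induction i using Fin.induction with
  | zero =>
    rw [r.stage_zero]
    exact ⟨B.reindex (Equiv.subtypeUnivEquiv fun j l hl => absurd hl (Fin.not_lt_zero _)).symm
      fun j => rfl⟩
  | succ i ih =>
    obtain ⟨C⟩ := ih
    obtain ⟨p, -, -, hI, N, hN, h⟩ := r.step i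
    obtain ⟨D⟩ := C.quotient hI hN
    rw [h]
    refine ⟨D.reindex ((Equiv.subtypeSubtypeEquivSubtypeInter _ fun j => I j ≠ r.interval i).trans
      (Equiv.subtypeEquivRight fun j => ⟨fun hj l hl => ?_, fun hj => ⟨fun l hl => hj l ?_,
        hj i (Fin.castSucc_lt_succ)⟩⟩)) fun j => rfl⟩
    · rcases lt_or_eq_of_le (Fin.castSucc_lt_succ_iff.1 hl) with h' | rfl
      · exact hj.1 l (Fin.castSucc_lt_castSucc_iff.2 h')
      · exact hj.2
    · exact hl.trans (Fin.castSucc_lt_succ)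

theorem isMaximalInterval (r : TrueIntervalRun M k) (i : Fin k) :
    (r.stage i.castSucc).IsMaximalInterval (r.interval i) := by
  obtain ⟨p, -, -, hI, -⟩ := r.step i
  exact hI

theorem mult_pos (r : TrueIntervalRun M k) (i : Fin k) : 0 < r.mult i :=
  (r.isMaximalInterval i).1

/-- Every output interval occurs in the barcode, and has not been output before. -/
theorem exists_eq_interval [Finite J] (B : Barcode M I) (r : TrueIntervalRun M k) (i : Fin k) :
    ∃ j, I j = r.interval i ∧ ∀ l < i, r.interval i ≠ r.interval l := by
  obtain ⟨C⟩ := r.barcode_stage B i.castSucc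
  obtain ⟨j, hj⟩ := (C.rk_pos_iff _).1 (r.mult_pos i)
  have := (C.subset_iff_of_isMaximalInterval (r.isMaximalInterval i) j).1 hj
  exact ⟨j, this, fun l hl => this ▸ j.2 l (Fin.castSucc_lt_castSucc_iff.2 hl)⟩

theorem interval_injective [Finite J] (B : Barcode M I) (r : TrueIntervalRun M k) :
    Function.Injective r.interval := by
  intro a b hab
  obtain ⟨_, _, ha⟩ := r.exists_eq_interval B a
  obtain ⟨_, _, hb⟩ := r.exists_eq_interval B b
  rcases lt_trichotomy a b with h | h | h
  · exact absurd hab.symm (hb a h)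
  · exact h
  · exact absurd hab (ha b h)

/-- The number of iterations is at most the number of summands. -/
theorem le_card [Finite J] (B : Barcode M I) (r : TrueIntervalRun M k) : k ≤ Nat.card J := by
  choose f hf _ using r.exists_eq_interval B
  have : Function.Injective f := fun a b hab =>
    r.interval_injective B ((hf a).symm.trans ((congrArg I hab).trans (hf b)))
  simpa using Nat.card_le_card_of_injective f this

/-- An interval of the barcode that contains an output interval has been output up to then. -/
theorem exists_le_interval_eq [Finite J] (B : Barcode M I) (r : TrueIntervalRun M k) (i : Fin k)
    {j : J} (hj : (r.interval i).carrier ⊆ (I j).carrier) : ∃ l ≤ i, I j = r.interval l := by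
  -- Otherwise the bar is still present at stage `i`, so maximality forces it to equal the interval
  -- output there, contradicting `hne` at `i` itself.
  by_contra! hne
  obtain ⟨C⟩ := r.barcode_stage B i.castSucc
  have := (C.subset_iff_of_isMaximalInterval (r.isMaximalInterval i)
    ⟨j, fun l hl => hne l (Fin.castSucc_lt_castSucc_iff.1 hl).le⟩).1 hj
  exact hne i le_rfl this

/-- No earlier output equals the `i`-th interval, so all its copies in the original barcode survive
to stage `i`. -/
theorem mult_eq [Finite J] (B : Barcode M I) (r : TrueIntervalRun M k) (i : Fin k) :
    r.mult i = Nat.card {j // I j = r.interval i} := by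
  obtain ⟨C⟩ := r.barcode_stage B i.castSucc
  refine (C.rk_of_isMaximalInterval (r.isMaximalInterval i)).trans (Nat.card_congr ?_)
  refine (Equiv.subtypeSubtypeEquivSubtypeInter _ fun j => I j = r.interval i).trans
    (Equiv.subtypeEquivRight fun j => ⟨And.right, fun hj => ⟨fun l hl h => ?_, hj⟩⟩)
  exact hl.ne (congrArg _ (r.interval_injective B (h.symm.trans hj)))

/-- The bars containing the `i`-th interval are grouped by the iteration that outputs them, which is
at most `i`. The group of `i` itself gives the multiplicity, and the earlier groups give
`peeledBefore`. -/
theorem rk_interval [Finite J] (B : Barcode M I) (r : TrueIntervalRun M k) (i : Fin k) :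
    M.rk (r.interval i) = r.mult i + r.peeledBefore i := by
  classical
  have := Fintype.ofFinite J
  have hmult (l : Fin k) : r.mult l = (Finset.univ.filter fun j => I j = r.interval l).card := by
    rw [r.mult_eq B, Nat.card_eq_fintype_card, Fintype.card_subtype]
  have hset : (Finset.univ.filter fun j => (r.interval i).carrier ⊆ (I j).carrier) =
      (Finset.univ.filter fun l : Fin k =>
        l ≤ i ∧ (r.interval i).carrier ⊆ (r.interval l).carrier).biUnion
          fun l => Finset.univ.filter fun j => I j = r.interval l := by
    ext j
    simp only [Finset.mem_filter, Finset.mem_univ, true_and, Finset.mem_biUnion]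
    constructor
    · intro hj
      obtain ⟨l, hl, h⟩ := r.exists_le_interval_eq B i hj
      exact ⟨l, ⟨hl, h ▸ hj⟩, h⟩
    · rintro ⟨l, ⟨-, hl⟩, h⟩
      rwa [h]
  have hins : (Finset.univ.filter fun l : Fin k =>
        l ≤ i ∧ (r.interval i).carrier ⊆ (r.interval l).carrier) =
      insert i (Finset.univ.filter fun l : Fin k =>
        l < i ∧ (r.interval i).carrier ⊆ (r.interval l).carrier) := by
    ext l
    simp only [Finset.mem_filter, Finset.mem_univ, true_and, Finset.mem_insert,
      le_iff_eq_or_lt (a := l)]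
    constructor
    · rintro ⟨h | h, h'⟩
      exacts [Or.inl h, Or.inr ⟨h, h'⟩]
    · rintro (rfl | h)
      exacts [⟨Or.inl rfl, subset_rfl⟩, ⟨Or.inr h.1, h.2⟩]
  rw [B.rk_eq, Nat.card_eq_fintype_card, Fintype.card_subtype, hset, Finset.card_biUnion, hins,
    Finset.sum_insert (by simp), hmult, peeledBefore, ← Finset.sum_filter]
  · exact congrArg _ (Finset.sum_congr rfl fun l _ => (hmult l).symm)
  · intro a _ b _ hab
    exact Finset.disjoint_filter.2 fun j _ ha hb =>
      hab (r.interval_injective B (ha.symm.trans hb))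

/-- A module with a finite barcode is the direct sum of the output of a complete execution. -/
theorem isIsomorphic_of_isComplete [Finite J] (B : Barcode M I) (r : TrueIntervalRun M k)
    (hr : r.IsComplete) :
    M.IsIsomorphic (directSum fun i => intervalPower 𝔽 (r.interval i) (r.mult i)) := by
  -- A bar never output would survive to the final module and make it nonzero at the points of the
  -- bar.
  have hex (j : J) : ∃ i, r.interval i = I j := by
    by_contra! hne
    obtain ⟨C⟩ := r.barcode_stage B (Fin.last k)
    obtain ⟨p, hp⟩ := (I j).nonempty
    exact (C.dim_ne_zero_iff p).2 ⟨⟨j, fun l _ h => hne l h.symm⟩, hp⟩ (hr p)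
  choose f hf using hex
  have hcard (i : Fin k) : Nat.card {j // f j = i} = r.mult i := by
    rw [r.mult_eq B]
    refine Nat.card_congr (Equiv.subtypeEquivRight fun j => ?_)
    rw [← hf j, (r.interval_injective B).eq_iff]
  -- The fibre of `f` over `i` consists of `r.mult i` bars, which are matched with the copies in the
  -- `i`-th power.
  let e : J ≃ Σ i, Fin (r.mult i) :=
    (Equiv.sigmaFiberEquiv f).symm.trans
      (Equiv.sigmaCongrRight fun i => Finite.equivFinOfCardEq (hcard i))
  exact ⟨(B.reindex e hf).iso
    (Barcode.directSum fun i => Barcode.intervalPower (r.interval i) (r.mult i))⟩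

end TrueIntervalRun

/-- A pointwise finite-dimensional interval decomposable module over a finite poset has a finite
barcode. -/
theorem IsIntervalDecomposable.exists_barcode [Finite P] {M : PersistenceModule.{u, v, w} 𝔽 P}
    (h : M.IsIntervalDecomposable) (hM : ∀ p, Module.Finite 𝔽 (M.obj p)) :
    ∃ (J : Type) (_ : Finite J) (I : J → PosetInterval P), Nonempty (Barcode M I) := by
  obtain ⟨J, I, ⟨e⟩⟩ := h
  have B := ((Barcode.directSum fun j => Barcode.intervalModule (𝔽 := 𝔽) (I j)).reindex
    (I' := I) (Equiv.sigmaPUnit J) fun _ => rfl).ofIso e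
  exact ⟨J, B.finite_index hM, I, ⟨B⟩⟩

end PersistenceModule

theorem filtrationModule_finite {𝔽 : Type u} [Field 𝔽] {V : Type v} [LinearOrder V] {P : Type w}
    [PartialOrder P] {K : PreAbstractSimplicialComplex V} (hK : K.faces.Finite)
    (F : P →o Set.Iic K) (n : ℕ) (p : P) : Module.Finite 𝔽 ((filtrationModule 𝔽 F n).obj p) :=
  SimplicialHomology.homology_finite (hK.subset (F p).2) n

end

theorem mainTheorem5 {𝔽 : Type u} [Field 𝔽] {V : Type v} [LinearOrder V]
    (P : PosetInterval (ℤ × ℤ)) (hP : P.carrier.Finite)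
    (K : PreAbstractSimplicialComplex V) (hK : K.faces.Finite)
    (F : P.carrier →o Set.Iic K) (n : ℕ)
    (hM : (filtrationModule 𝔽 F n).IsIntervalDecomposable) :
    -- the procedure can be carried out: as long as the current module is nonzero at a point, there
    -- is a maximal interval through it, and every maximal interval can be peeled off
    (∀ (k : ℕ) (r : (filtrationModule 𝔽 F n).TrueIntervalRun k),
      (∀ p, r.final.dim p ≠ 0 → ∃ I, r.final.IsMaximalInterval I ∧ p ∈ I.carrier) ∧
      (∀ I, r.final.IsMaximalInterval I → ∃ N, r.final.IsPeelable I N)) ∧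
    -- it terminates
    (∃ B : ℕ, ∀ (k : ℕ), (filtrationModule 𝔽 F n).TrueIntervalRun k → k ≤ B) ∧
    -- its output is correct
    (∀ (k : ℕ) (r : (filtrationModule 𝔽 F n).TrueIntervalRun k), r.IsComplete →
      Function.Injective r.interval ∧
      (∀ i, 0 < r.mult i ∧
        (filtrationModule 𝔽 F n).rk (r.interval i) = r.mult i + r.peeledBefore i) ∧
      (filtrationModule 𝔽 F n).IsIsomorphic
        (PersistenceModule.directSum fun i =>
          PersistenceModule.intervalPower 𝔽 (r.interval i) (r.mult i))) := by
  have : Finite P.carrier := hP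
  obtain ⟨J, _, I, ⟨B⟩⟩ := hM.exists_barcode (filtrationModule_finite hK F n)
  refine ⟨fun k r => ?_, ⟨Nat.card J, fun k r => r.le_card B⟩, fun k r hr =>
    ⟨r.interval_injective B, fun i => ⟨r.mult_pos i, r.rk_interval B i⟩,
      r.isIsomorphic_of_isComplete B hr⟩⟩
  -- The last stage of any run, complete or not, again has a finite barcode, so the existence
  -- results for barcodes apply to it.
  obtain ⟨C⟩ := r.barcode_stage B (Fin.last k)
  refine ⟨fun p hp => ?_, fun I₀ hI₀ => C.exists_isPeelable hI₀⟩
  obtain ⟨j, hj⟩ := (C.dim_ne_zero_iff p).1 hp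
  obtain ⟨I₀, hI₀, hle⟩ := C.exists_isMaximalInterval j
  exact ⟨I₀, hI₀, hle hj⟩
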